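/- Let $G$ be a connected, locally finite graph with vertex set $V$, graph metric $d$ and a fixed base vertex $e$; write $|v|=d(e,v)$. Let $P=(p(v,w))_{v,w\in V}$ be a stochastic matrix, $p^{(n)}(v,w)$ its $n$-step transition probabilities, and let $(Z_n)$ be the random walk with transition matrix $P$, with law $\mathbb P_v$ when started at $v$. Assume: (i) (uniform irreducibility) there are $\varepsilon_0>0$ and $K$ such that for all neighbours $v\sim w$ there is $k<K$ with $p^{(k)}(v,w)\ge\varepsilon_0$; (ii) (uniform first moment) $\sum_{n\ge1}\phi(n)<\infty$, where $\phi(n)=\sup_{v}\sum_{w:\,d(v,w)\ge n}p(v,w)$; (iii) the spectral radius $\rho=\rho(P)=\limsup_{n\to\infty}p^{(n)}(v,w)^{1/n}$ (which does not depend on $v,w$) satisfies $\rho<1$, and there is a constant $C>0$ with $p^{(n)}(v,w)\le C\rho^n$ for all $v,w\in V$ and $n\in\mathbb N$. Let $f:\mathbb N\to(0,\infty)$ be a Floyd function, that is, $\sum_n f(n)<\infty$ and there is $\lambda>0$ with $\lambda f(r)\le f(r+1)\le f(r)$ for all $r>0$; assume moreover that $\sum_n n f(n)<\infty$. Give each edge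 $[v,w]$ the length $f(\min\{|v|,|w|\})$, let $d_f(v,w)$ be the infimum of the lengths of the paths from $v$ to $w$, let $\overline G$ be the completion of $(V,d_f)$ (the Floyd compactification) and $\partial_f G=\overline G\setminus V$ the Floyd boundary. Then the Dirichlet problem at infinity is solvable: for every continuous $g:\partial_f G\to\mathbb R$ there is a continuous $h:\overline G\to\mathbb R$ with $h=g$ on $\partial_f G$ and $h(v)=\sum_w p(v,w)h(w)$ for every $v\in V$. Moreover (this is an equivalent form of solvability), for every starting point $Z_n$ converges almost surely in $\overline G$ to a random point of $\partial_f G$, and the hitting distributions $\mu_v$, where $\mu_v$ is the law of $\lim_n Z_n$ under $\mathbb P_v$, converge weakly to the Dirac measure $\delta_\xi$ as $v\to\xi$ with $v\in V$, for every $\xi\in\partial_f G$. -/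

import Mathlib

open MeasureTheory ProbabilityTheory Filter Topology
open scoped NNReal ENNReal

noncomputable section

namespace Floyd

/-! ### Random walks given by a transition matrix -/

section Walk

variable {V : Type*}

/-- `nStep P n v w` is the `n`-step transition probability `p^(n)(v,w)` of the chain whose transition
matrix has the probability distribution `P v = p(v, ·)` as its row with index `v`. -/
def nStep (P : V → PMF V) : ℕ → V → PMF V
  | 0, v => PMF.pure v
  | n + 1, v => (P v).bind (nStep P n)

/-- `limsup_n p^(n)(v,w)^(1/n)`; for an irreducible chain this number does not depend on `v`, `w`
and is the spectral radius of `P`. -/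
def spectralRadius (P : V → PMF V) (v w : V) : ℝ≥0∞ :=
  limsup (fun n : ℕ => (nStep P n v w) ^ (1 / (n : ℝ))) atTop

/-- There are `ε₀ > 0` and `K` such that any two neighbours `v`, `w` satisfy
`p^(k)(v,w) ≥ ε₀` for some `k < K`. -/
def UniformlyIrreducible (G : SimpleGraph V) (P : V → PMF V) : Prop :=
  ∃ ε₀ : ℝ≥0∞, 0 < ε₀ ∧ ∃ K : ℕ, ∀ v w : V, G.Adj v w → ∃ k < K, ε₀ ≤ nStep P k v w

/-- The step length distribution `σ_v(n) = ∑_{w : d(v,w) = n} p(v,w)`. -/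
def stepLength (G : SimpleGraph V) (P : V → PMF V) (v : V) : PMF ℕ :=
  (P v).map (fun w => G.dist v w)

/-- The uniform tail `φ(n) = sup_v σ_v([n, ∞))`. -/
def stepTail (G : SimpleGraph V) (P : V → PMF V) (n : ℕ) : ℝ≥0∞ :=
  ⨆ v : V, (stepLength G P v).toMeasure (Set.Ici n)

/-- Uniform first moment: `∑_{n ≥ 1} φ(n) < ∞`. -/
def UniformFirstMoment (G : SimpleGraph V) (P : V → PMF V) : Prop :=
  ∑' n : ℕ, stepTail G P (n + 1) < ∞

variable [MeasurableSpace V] [DiscreteMeasurableSpace V]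

/-- The law of the next position given the positions up to time `n`: the row of `P` at the
position at time `n`. -/
def stepKernel (P : V → PMF V) (n : ℕ) :
    Kernel ((i : Finset.Iic n) → (fun _ : ℕ => V) i) V where
  toFun x := (P (x ⟨n, Finset.mem_Iic.2 le_rfl⟩)).toMeasure
  measurable' :=
    (Measurable.of_discrete (f := fun v : V => (P v).toMeasure)).comp (measurable_pi_apply _)

instance (P : V → PMF V) (n : ℕ) : IsMarkovKernel (stepKernel P n) :=
  ⟨fun x => PMF.toMeasure.isProbabilityMeasure (P (x ⟨n, Finset.mem_Iic.2 le_rfl⟩))⟩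

/-- `ℙ_v`: the law on the trajectory space `ℕ → V` of the random walk with transition matrix `P`
started at `v`. The walk `Z_n` is the coordinate process `z ↦ z n`. -/
def pathMeasure (P : V → PMF V) (v : V) : Measure (ℕ → V) :=
  Kernel.traj (X := fun _ : ℕ => V) (stepKernel P) 0 (fun _ => v)

instance (P : V → PMF V) (v : V) : IsProbabilityMeasure (pathMeasure P v) := by
  unfold pathMeasure; infer_instance

end Walk

/-! ### The Floyd compactification -/

section Compactification

variable {V : Type*}

/-- Floyd functions: positive, summable, and `l * f r ≤ f (r+1) ≤ f r` for all `r > 0`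
with a constant `l > 0`. -/
structure IsFloydFunction (f : ℕ → ℝ≥0) : Prop where
  pos : ∀ n, 0 < f n
  summable : Summable f
  exists_le : ∃ l : ℝ≥0, 0 < l ∧ ∀ r, 0 < r → l * f r ≤ f (r + 1)
  antitone : ∀ r, 0 < r → f (r + 1) ≤ f r

/-- The Floyd length of an edge `[v,w]`: the value of `f` at `min (d(e,v)) (d(e,w))`. -/
def edgeLength (G : SimpleGraph V) (e : V) (f : ℕ → ℝ≥0) (v w : V) : ℝ≥0 :=
  f (min (G.dist e v) (G.dist e w))

/-- The Floyd length of a path: the sum of the Floyd lengths of its edges. -/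
def floydLength (G : SimpleGraph V) (e : V) (f : ℕ → ℝ≥0) {v w : V} (p : G.Walk v w) : ℝ≥0 :=
  (p.darts.map (fun a => edgeLength G e f a.fst a.snd)).sum

/-- `d_f(v,w)`: the infimum of the Floyd lengths of all paths from `v` to `w` (finite if the
graph is connected). -/
def floydDist (G : SimpleGraph V) (e : V) (f : ℕ → ℝ≥0) (v w : V) : ℝ≥0∞ :=
  ⨅ p : G.Walk v w, (floydLength G e f p : ℝ≥0∞)

/-- The vertex set, to be equipped with the distance `d_f`. -/
@[nolint unusedArguments]
def FloydSpace (_G : SimpleGraph V) (_e : V) (_f : ℕ → ℝ≥0) : Type _ := V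

theorem floydDist_self (G : SimpleGraph V) (e : V) (f : ℕ → ℝ≥0) (v : V) :
    floydDist G e f v v = 0 :=
  le_antisymm ((iInf_le _ SimpleGraph.Walk.nil).trans (by simp [floydLength])) bot_le

theorem floydDist_comm_le (G : SimpleGraph V) (e : V) (f : ℕ → ℝ≥0) (v w : V) :
    floydDist G e f v w ≤ floydDist G e f w v := by
  refine le_iInf fun p => (iInf_le _ p.reverse).trans (le_of_eq ?_)
  congr 1
  simp only [floydLength, SimpleGraph.Walk.darts_reverse, List.map_reverse, List.sum_reverse,
    List.map_map]
  congr 1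
  refine List.map_congr_left fun a _ => ?_
  simp [edgeLength, min_comm]

theorem floydDist_triangle (G : SimpleGraph V) (e : V) (f : ℕ → ℝ≥0) (u v w : V) :
    floydDist G e f u w ≤ floydDist G e f u v + floydDist G e f v w := by
  unfold floydDist
  rw [ENNReal.iInf_add]
  refine le_iInf fun p => ?_
  rw [ENNReal.add_iInf]
  refine le_iInf fun q => (iInf_le _ (p.append q)).trans (le_of_eq ?_)
  simp [floydLength, SimpleGraph.Walk.darts_append]

instance (G : SimpleGraph V) (e : V) (f : ℕ → ℝ≥0) : PseudoEMetricSpace (FloydSpace G e f) where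
  edist v w := floydDist G e f v w
  edist_self v := floydDist_self G e f v
  edist_comm v w := le_antisymm (floydDist_comm_le G e f v w) (floydDist_comm_le G e f w v)
  edist_triangle u v w := floydDist_triangle G e f u v w

/-- The Floyd compactification: the completion of the vertex set with respect to `d_f`. -/
abbrev FloydCompletion (G : SimpleGraph V) (e : V) (f : ℕ → ℝ≥0) : Type _ :=
  UniformSpace.Completion (FloydSpace G e f)

/-- A vertex as a point of the Floyd compactification. -/
def toCompletion (G : SimpleGraph V) (e : V) (f : ℕ → ℝ≥0) (v : V) : FloydCompletion G e f :=
  UniformSpace.Completion.coe' (show FloydSpace G e f from v)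

/-- The Floyd boundary `∂_f G`: the points of the completion that are not vertices. -/
def floydBoundary (G : SimpleGraph V) (e : V) (f : ℕ → ℝ≥0) : Set (FloydCompletion G e f) :=
  (Set.range (toCompletion G e f))ᶜ

instance (G : SimpleGraph V) (e : V) (f : ℕ → ℝ≥0) : MeasurableSpace (FloydCompletion G e f) :=
  borel _

instance (G : SimpleGraph V) (e : V) (f : ℕ → ℝ≥0) : BorelSpace (FloydCompletion G e f) :=
  ⟨rfl⟩

/-- `v → ξ`, with `v` ranging over the vertices and the convergence taking place in the Floyd
compactification. -/
def vertexNhds (G : SimpleGraph V) (e : V) (f : ℕ → ℝ≥0) (ξ : floydBoundary G e f) : Filter V :=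
  comap (toCompletion G e f) (𝓝 (ξ : FloydCompletion G e f))

/-- The Dirichlet problem at infinity is solvable: every continuous function on the Floyd boundary
extends to a continuous function on the Floyd compactification that is `P`-harmonic on the
vertices. -/
def DirichletSolvable (G : SimpleGraph V) (e : V) (f : ℕ → ℝ≥0) (P : V → PMF V) : Prop :=
  ∀ g : C(floydBoundary G e f, ℝ), ∃ h : C(FloydCompletion G e f, ℝ),
    (∀ v : V, HasSum (fun w : V => (P v w).toReal * h (toCompletion G e f w))
      (h (toCompletion G e f v))) ∧
    ∀ ξ : floydBoundary G e f, h ξ = g ξ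

variable [MeasurableSpace V] [DiscreteMeasurableSpace V]

/-- `L` is the limit of the random walk in the Floyd boundary: it is measurable, and from every
starting point `Z_n` converges almost surely to the boundary point `L`. -/
structure IsBoundaryLimit (G : SimpleGraph V) (e : V) (f : ℕ → ℝ≥0) (P : V → PMF V)
    (L : (ℕ → V) → floydBoundary G e f) : Prop where
  measurable : Measurable L
  ae_tendsto : ∀ v : V, ∀ᵐ z ∂(pathMeasure P v),
    Tendsto (fun n => toCompletion G e f (z n)) atTop (𝓝 (L z : FloydCompletion G e f))

/-- The hitting distribution `μ_v`: the law under `ℙ_v` of the limit of the random walk, a Borel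
probability measure on the Floyd boundary. -/
def hittingDistribution {G : SimpleGraph V} {e : V} {f : ℕ → ℝ≥0} {P : V → PMF V}
    {L : (ℕ → V) → floydBoundary G e f} (hL : IsBoundaryLimit G e f P L) (v : V) :
    ProbabilityMeasure (floydBoundary G e f) :=
  ProbabilityMeasure.map ⟨pathMeasure P v, inferInstance⟩ hL.measurable.aemeasurable

/-- The Dirac measure at a boundary point. -/
def diracAt {G : SimpleGraph V} {e : V} {f : ℕ → ℝ≥0} (ξ : floydBoundary G e f) :
    ProbabilityMeasure (floydBoundary G e f) :=
  ⟨Measure.dirac ξ, inferInstance⟩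

end Compactification

end Floyd

end

/-!
The proof rests on the expected Floyd length `U(v) = E_v ∑_n d_f(Z_n, Z_{n+1})` of a trajectory
(`totalFloydLength`): it is finite, and it tends to `0` as `v` tends to infinity
(`totalFloydLength_ne_top_and_tendsto`). Two estimates give this.

* One step from `w` has expected Floyd length at most `Ψ(|w|)`, where `Ψ` is antitone and summable
  (`stepFloydLength_le`, `tsum_stepBound_ne_top`). A step of length `k ≤ |w| / 2` only uses edges of
  length at most `f(|w| / 2)`, up to the irregularity of `f` at `0`, so such steps contribute at
  most the first moment times `f(|w| / 2)`. A longer step has Floyd length at most the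
  diameter, and probability at most `φ(|w| / 2 + 1)`.
* The walk escapes at linear speed, uniformly in the starting point
  (`exists_summable_bound_evolve`). Uniform irreducibility bounds the degrees, so balls grow at most
  exponentially, and `p^(n)(v,w) ≤ C ρ^n` makes the probability of `|Z_n| ≤ n / q` exponentially
  small for large `q`.

Hence the `n`-th term of `U(v)` is at most `b_n` with `∑ b_n < ∞` and `b` independent of `v`. For
fixed `n` the term tends to `0` as `v → ∞`, because `P` maps functions vanishing at infinity to
functions vanishing at infinity (`tendsto_evolve`), and dominated convergence concludes.

Since `U` is finite, almost every trajectory is Cauchy for `d_f`, hence converges in the completion.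
The completion is compact and vertices are isolated in it; as the walk is transient, the limit `Z_∞`
lies in the boundary (`ae_exists_tendsto_floydBoundary`). For a continuous function `g` on the
compactification, `h(v) = E_v g(Z_∞)` is the limit of `Pⁿ g(v)`, so it is harmonic. Since
`|g(x) - g(v)| ≤ ε + c d_f(v,x)` with `c` depending only on `g` and `ε`, one gets
`|h(v) - g(v)| ≤ ε + c U(v)`, so `h - g` vanishes at infinity
(`IsBoundaryLimit.tendsto_boundaryMean_sub`), and `h` extends continuously by `g` on the boundary
(`exists_continuous_extension`). Tietze's theorem supplies such a `g` for given boundary values.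
Continuity of the extension at a boundary point `ξ` is the weak convergence `μ_v → δ_ξ`.
-/

noncomputable section

namespace Floyd

/-! ### The random walk and its transition operators -/

section Walk

variable {V : Type*}

theorem nStep_succ_eq_bind (P : V → PMF V) (n : ℕ) (v : V) :
    nStep P (n + 1) v = (nStep P n v).bind P := by
  induction n generalizing v with
  | zero =>
    change (P v).bind (fun w => PMF.pure w) = (PMF.pure v).bind P
    rw [PMF.bind_pure, PMF.pure_bind]
  | succ n ih =>
    change (P v).bind (nStep P (n + 1)) = ((P v).bind (nStep P n)).bind P
    rw [PMF.bind_bind]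
    congr 1
    funext w
    exact ih w

/-- The action `(Pⁿ g)(v) = ∑_w p^(n)(v,w) g(w)` of the `n`-step transition matrix on nonnegative
functions. -/
def evolve (P : V → PMF V) (n : ℕ) (g : V → ℝ≥0∞) (v : V) : ℝ≥0∞ :=
  ∑' w, nStep P n v w * g w

theorem evolve_mono (P : V → PMF V) (n : ℕ) {g g' : V → ℝ≥0∞} (h : ∀ w, g w ≤ g' w) (v : V) :
    evolve P n g v ≤ evolve P n g' v :=
  ENNReal.tsum_le_tsum fun w => mul_le_mul_right (h w) _

theorem evolve_const (P : V → PMF V) (n : ℕ) (c : ℝ≥0∞) (v : V) :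
    evolve P n (fun _ => c) v = c := by
  rw [evolve, ENNReal.tsum_mul_right, PMF.tsum_coe, one_mul]

theorem evolve_zero (P : V → PMF V) (g : V → ℝ≥0∞) (v : V) : evolve P 0 g v = g v := by
  classical
  rw [evolve, tsum_eq_single v]
  · simp [nStep]
  · intro w hw
    simp [nStep, PMF.pure_apply, hw]

theorem evolve_succ (P : V → PMF V) (n : ℕ) (g : V → ℝ≥0∞) (v : V) :
    evolve P (n + 1) g v = ∑' u, P v u * evolve P n g u := by
  simp only [evolve, nStep, PMF.bind_apply]
  simp_rw [← ENNReal.tsum_mul_right, ← ENNReal.tsum_mul_left, mul_assoc]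
  exact ENNReal.tsum_comm

variable [MeasurableSpace V] [DiscreteMeasurableSpace V] [Countable V]

theorem lintegral_toMeasure (p : PMF V) (g : V → ℝ≥0∞) :
    ∫⁻ w, g w ∂p.toMeasure = ∑' w, p w * g w := by
  rw [lintegral_countable']
  refine tsum_congr fun w => ?_
  rw [PMF.toMeasure_apply_singleton _ _ (measurableSet_singleton w), mul_comm]

/-- The one-step Markov property: given the path up to time `n`, the position at time `n + 1` is
distributed according to the row of `P` at the position at time `n`. -/
theorem lintegral_pathMeasure_succ (P : V → PMF V) (v : V) (n : ℕ) (g : V → V → ℝ≥0∞) :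
    ∫⁻ z, g (z n) (z (n + 1)) ∂pathMeasure P v =
      ∫⁻ z, ∑' u, P (z n) u * g (z n) u ∂pathMeasure P v := by
  have hg : Measurable (Function.uncurry g) := Measurable.of_discrete
  have hm : Measurable fun q : ((i : Finset.Iic n) → V) × V =>
      g (q.1 ⟨n, Finset.mem_Iic.2 le_rfl⟩) q.2 :=
    hg.comp (f := fun q : ((i : Finset.Iic n) → V) × V =>
      (q.1 ⟨n, Finset.mem_Iic.2 le_rfl⟩, q.2)) (by fun_prop)
  have key := Kernel.partialTraj_compProd_eq_map_traj (X := fun _ : ℕ => V)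
    (κ := stepKernel P) (Nat.zero_le n) (x₀ := fun _ => v)
  have h1 : ∫⁻ z, g (z n) (z (n + 1)) ∂pathMeasure P v =
      ∫⁻ q, g (q.1 ⟨n, Finset.mem_Iic.2 le_rfl⟩) q.2
        ∂(Kernel.partialTraj (X := fun _ : ℕ => V) (stepKernel P) 0 n (fun _ => v)
          ⊗ₘ stepKernel P n) := by
    rw [key, lintegral_map hm (by fun_prop)]
    rfl
  rw [h1, Measure.lintegral_compProd hm, ← Kernel.traj_map_frestrictLe_apply, lintegral_map]
  · refine lintegral_congr fun z => ?_
    exact lintegral_toMeasure (P (z n)) (g (z n))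
  · exact hm.lintegral_kernel_prod_right'
  · fun_prop

theorem pathMeasure_ae_zero (P : V → PMF V) (v : V) : ∀ᵐ z ∂pathMeasure P v, z 0 = v := by
  have h : (pathMeasure P v).map (Preorder.frestrictLe (π := fun _ : ℕ => V) 0) =
      Measure.dirac (fun _ => v) := by
    unfold pathMeasure
    rw [Kernel.traj_map_frestrictLe_apply, Kernel.partialTraj_self]
    rfl
  have h2 : ∀ᵐ x ∂(pathMeasure P v).map (Preorder.frestrictLe (π := fun _ : ℕ => V) 0),
      x ⟨0, Finset.mem_Iic.2 le_rfl⟩ = v := by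
    rw [h, ae_dirac_iff]
    exact measurable_pi_apply (X := fun _ : Finset.Iic 0 => V) _ (measurableSet_singleton v)
  exact ae_of_ae_map (by fun_prop) h2

theorem lintegral_pathMeasure (P : V → PMF V) (v : V) (n : ℕ) (g : V → ℝ≥0∞) :
    ∫⁻ z, g (z n) ∂pathMeasure P v = evolve P n g v := by
  induction n generalizing g with
  | zero =>
    rw [evolve_zero, lintegral_congr_ae (g := fun _ => g v)]
    · simp
    · filter_upwards [pathMeasure_ae_zero P v] with z hz
      rw [hz]
  | succ n ih =>
    rw [lintegral_pathMeasure_succ P v n (fun _ u => g u), ih (fun w => ∑' u, P w u * g u)]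
    simp only [evolve, nStep_succ_eq_bind, PMF.bind_apply]
    simp_rw [← ENNReal.tsum_mul_right, ← ENNReal.tsum_mul_left, mul_assoc]
    exact ENNReal.tsum_comm

theorem map_pathMeasure (P : V → PMF V) (v : V) (n : ℕ) :
    (pathMeasure P v).map (fun z => z n) = (nStep P n v).toMeasure := by
  ext s hs
  rw [← lintegral_indicator_one hs, ← lintegral_indicator_one hs,
    lintegral_map (measurable_one.indicator hs) (by fun_prop), lintegral_toMeasure]
  exact lintegral_pathMeasure P v n (s.indicator 1)

/-- `(P^{n+1} g)(v) = ∑_u p(v,u) (Pⁿ g)(u)` for bounded real functions, expectations being taken on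
the trajectory space. -/
theorem integral_pathMeasure_succ (P : V → PMF V) (g : V → ℝ) {B : ℝ} (hB : ∀ w, ‖g w‖ ≤ B)
    (n : ℕ) (v : V) :
    ∫ z, g (z (n + 1)) ∂pathMeasure P v =
      ∫ u, ∫ z, g (z n) ∂pathMeasure P u ∂(P v).toMeasure := by
  have hmeas : Measurable g := Measurable.of_discrete
  have hint : ∀ μ : Measure V, IsProbabilityMeasure μ → Integrable g μ := fun μ _ =>
    Integrable.of_bound hmeas.aestronglyMeasurable B (ae_of_all _ hB)
  have hmap : ∀ m u, ∫ z, g (z m) ∂pathMeasure P u = ∫ w, g w ∂(nStep P m u).toMeasure := by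
    intro m u
    rw [← map_pathMeasure,
      integral_map (measurable_pi_apply m).aemeasurable hmeas.aestronglyMeasurable]
  simp_rw [hmap]
  let κ : Kernel V V := ⟨fun u => (nStep P n u).toMeasure, Measurable.of_discrete⟩
  have hbind : (nStep P (n + 1) v).toMeasure = κ ∘ₘ (P v).toMeasure := by
    ext s hs
    rw [Measure.bind_apply hs κ.aemeasurable, lintegral_toMeasure]
    exact PMF.toMeasure_bind_apply _ _ _ hs
  have hi : Integrable g (κ ∘ₘ (P v).toMeasure) := by
    rw [← hbind]
    exact hint _ inferInstance
  rw [hbind]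
  exact Kernel.integral_comp (η := κ) (κ := Kernel.const Unit (P v).toMeasure) (a := ()) hi

end Walk

/-! ### Uniform tails of the step length -/

section Tails

variable {V : Type*}

/-- The filter of neighbourhoods of infinity of a graph with base vertex `e`: `v → ∞` means
`d(e,v) → ∞`. -/
abbrev atInfinity (G : SimpleGraph V) (e : V) : Filter V :=
  comap (fun v => G.dist e v) atTop

theorem eventually_atInfinity {G : SimpleGraph V} {e : V} {p : V → Prop} :
    (∀ᶠ v in atInfinity G e, p v) ↔ ∃ R : ℕ, ∀ v, R ≤ G.dist e v → p v := by
  rw [eventually_comap, eventually_atTop]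
  constructor
  · rintro ⟨R, h⟩
    exact ⟨R, fun v hv => h _ hv v rfl⟩
  · rintro ⟨R, h⟩
    exact ⟨R, fun _ hb v hv => h v (hv ▸ hb)⟩

theorem tsum_step_tail_le (G : SimpleGraph V) (P : V → PMF V) (v : V) (n : ℕ) :
    ∑' u, P v u * (if n ≤ G.dist v u then 1 else 0) ≤ stepTail G P n := by
  refine le_trans (le_of_eq ?_)
    (le_iSup (fun v => (stepLength G P v).toMeasure (Set.Ici n)) v)
  rw [PMF.toMeasure_apply_eq_toOuterMeasure, stepLength, PMF.toOuterMeasure_map_apply,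
    PMF.toOuterMeasure_apply]
  refine tsum_congr fun u => ?_
  by_cases h : n ≤ G.dist v u <;> simp [Set.indicator, h]

theorem tsum_step_dist_le (G : SimpleGraph V) (P : V → PMF V) (v : V) :
    ∑' u, P v u * (G.dist v u : ℝ≥0∞) ≤ ∑' n : ℕ, stepTail G P (n + 1) := by
  have key : ∀ d : ℕ, (d : ℝ≥0∞) = ∑' n : ℕ, if n + 1 ≤ d then 1 else 0 := by
    intro d
    rw [tsum_eq_sum (s := Finset.range d)]
    · rw [Finset.sum_congr rfl (g := fun _ => (1 : ℝ≥0∞))]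
      · simp
      · intro n hn
        rw [if_pos (Nat.succ_le_of_lt (Finset.mem_range.1 hn))]
    · intro n hn
      rw [if_neg]
      simpa using hn
  calc ∑' u, P v u * (G.dist v u : ℝ≥0∞)
      = ∑' u, ∑' n : ℕ, P v u * (if n + 1 ≤ G.dist v u then 1 else 0) := by
        refine tsum_congr fun u => ?_
        rw [ENNReal.tsum_mul_left, ← key]
    _ = ∑' n : ℕ, ∑' u, P v u * (if n + 1 ≤ G.dist v u then 1 else 0) := ENNReal.tsum_comm
    _ ≤ _ := ENNReal.tsum_le_tsum fun n => tsum_step_tail_le G P v (n + 1)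

theorem UniformFirstMoment.tendsto_stepTail {G : SimpleGraph V} {P : V → PMF V}
    (h : UniformFirstMoment G P) : Tendsto (stepTail G P) atTop (𝓝 0) :=
  (tendsto_add_atTop_iff_nat 1).1 (ENNReal.tendsto_atTop_zero_of_tsum_ne_top h.ne)

/-- A transition matrix with uniformly small tails maps bounded functions vanishing at infinity to
functions vanishing at infinity: from a vertex far out, the walk is still far out after a bounded
number of steps with probability close to one. -/
theorem tendsto_evolve {G : SimpleGraph V} (hconn : G.Connected) {e : V} {P : V → PMF V}
    (hφ : Tendsto (stepTail G P) atTop (𝓝 0)) {g : V → ℝ≥0∞} {B : ℝ≥0∞} (hB : B ≠ ∞)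
    (hgB : ∀ v, g v ≤ B) (hg : Tendsto g (atInfinity G e) (𝓝 0)) (n : ℕ) :
    Tendsto (evolve P n g) (atInfinity G e) (𝓝 0) := by
  induction n with
  | zero =>
    refine hg.congr fun v => (evolve_zero P g v).symm
  | succ n ih =>
    have hbound : ∀ v, evolve P n g v ≤ B := fun v =>
      (evolve_mono P n hgB v).trans_eq (evolve_const P n B v)
    rw [ENNReal.tendsto_nhds_zero] at ih ⊢
    intro ε hε
    have hε2 : 0 < ε / 2 := ENNReal.half_pos hε.ne'
    obtain ⟨R, hR⟩ := eventually_atInfinity.1 (ih (ε / 2) hε2)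
    have hφ' : Tendsto (fun n => stepTail G P n * B) atTop (𝓝 0) := by
      simpa using ENNReal.Tendsto.mul_const hφ (Or.inr hB)
    obtain ⟨N, hN⟩ := eventually_atTop.1 (ENNReal.tendsto_nhds_zero.1 hφ' (ε / 2) hε2)
    refine eventually_atInfinity.2 ⟨R + N, fun v hv => ?_⟩
    have hpt : ∀ u, evolve P n g u ≤ ε / 2 + (if N ≤ G.dist v u then 1 else 0) * B := by
      intro u
      by_cases hu : N ≤ G.dist v u
      · rw [if_pos hu, one_mul]
        exact (hbound u).trans le_add_self
      · refine (hR u ?_).trans le_self_add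
        have := hconn.dist_triangle (u := e) (v := u) (w := v)
        rw [SimpleGraph.dist_comm (u := u)] at this
        omega
    calc evolve P (n + 1) g v = ∑' u, P v u * evolve P n g u := evolve_succ P n g v
      _ ≤ ∑' u, P v u * (ε / 2 + (if N ≤ G.dist v u then 1 else 0) * B) :=
          ENNReal.tsum_le_tsum fun u => mul_le_mul_right (hpt u) _
      _ = ε / 2 + (∑' u, P v u * (if N ≤ G.dist v u then 1 else 0)) * B := by
          simp_rw [mul_add, ← mul_assoc]
          rw [ENNReal.tsum_add, ENNReal.tsum_mul_right, ENNReal.tsum_mul_right, PMF.tsum_coe,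
            one_mul]
      _ ≤ ε / 2 + ε / 2 := by
          gcongr
          exact (mul_le_mul_left (tsum_step_tail_le G P v N) B).trans (hN N le_rfl)
      _ = ε := ENNReal.add_halves ε

end Tails

/-! ### Growth of balls -/

section Growth

variable {V : Type*}

/-- Uniform irreducibility bounds the degrees: each of the `deg v` neighbours of `v` takes at least
`ε₀` of the total mass `K` of the first `K` transition probabilities from `v`. -/
theorem UniformlyIrreducible.exists_degree_bound {G : SimpleGraph V} {P : V → PMF V}
    (h : UniformlyIrreducible G P) :
    ∃ Δ : ℕ, ∀ (v : V) (s : Finset V), (∀ w ∈ s, G.Adj v w) → s.card ≤ Δ := by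
  obtain ⟨ε₀, hε₀, K, hK⟩ := h
  have hfin : (K : ℝ≥0∞) / ε₀ ≠ ∞ := ENNReal.div_ne_top (ENNReal.natCast_ne_top K) hε₀.ne'
  obtain ⟨Δ, hΔ⟩ := ENNReal.exists_nat_gt hfin
  refine ⟨Δ, fun v s hs => ?_⟩
  have hle : (s.card : ℝ≥0∞) * ε₀ ≤ K := by
    calc (s.card : ℝ≥0∞) * ε₀ = ∑ w ∈ s, ε₀ := by simp
      _ ≤ ∑ w ∈ s, ∑ k ∈ Finset.range K, nStep P k v w := by
          refine Finset.sum_le_sum fun w hw => ?_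
          obtain ⟨k, hk, hle⟩ := hK v w (hs w hw)
          exact hle.trans (Finset.single_le_sum (f := fun k => nStep P k v w)
            (fun _ _ => zero_le) (Finset.mem_range.2 hk))
      _ = ∑ k ∈ Finset.range K, ∑ w ∈ s, nStep P k v w := Finset.sum_comm
      _ ≤ ∑ k ∈ Finset.range K, 1 := by
          refine Finset.sum_le_sum fun k _ => ?_
          exact (ENNReal.sum_le_tsum s).trans_eq (PMF.tsum_coe _)
      _ = K := by simp
  by_contra! hlt
  have hdiv : (s.card : ℝ≥0∞) ≤ K / ε₀ := by
    rcases eq_or_ne ε₀ ∞ with rfl | htop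
    · have : s.card = 0 := by
        by_contra h0
        rw [ENNReal.mul_top (by exact_mod_cast h0)] at hle
        exact (ENNReal.natCast_ne_top K) (top_le_iff.1 hle)
      simp [this]
    · exact (ENNReal.le_div_iff_mul_le (Or.inl hε₀.ne') (Or.inl htop)).2 hle
  have : (s.card : ℝ≥0∞) < Δ := hdiv.trans_lt hΔ
  exact absurd (by exact_mod_cast this : s.card < Δ) (by omega)

theorem exists_adj_dist {G : SimpleGraph V} (hconn : G.Connected) {e v : V} {n : ℕ}
    (h : G.dist e v = n + 1) : ∃ u, G.Adj v u ∧ G.dist e u = n := by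
  obtain ⟨p, hp⟩ := hconn.exists_walk_length_eq_dist v e
  cases p with
  | nil => simp at h
  | cons hadj q =>
    rename_i u
    refine ⟨u, hadj, ?_⟩
    have h1 : G.dist u e ≤ q.length := SimpleGraph.dist_le q
    have h2 := hconn.dist_triangle (u := e) (v := u) (w := v)
    have h3 : G.dist u v = 1 := SimpleGraph.dist_eq_one_iff_adj.2 hadj.symm
    rw [SimpleGraph.Walk.length_cons, SimpleGraph.dist_comm] at hp
    rw [SimpleGraph.dist_comm] at h1
    omega

/-- Balls of radius `n` have at most `(Δ + 1)^n` elements if all degrees are at most `Δ`. -/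
theorem exists_ball_finset {G : SimpleGraph V} (hconn : G.Connected) (e : V) {Δ : ℕ}
    (hlf : ∀ v : V, (G.neighborSet v).Finite)
    (hΔ : ∀ (v : V) (s : Finset V), (∀ w ∈ s, G.Adj v w) → s.card ≤ Δ) (n : ℕ) :
    ∃ s : Finset V, (∀ v, v ∈ s ↔ G.dist e v ≤ n) ∧ s.card ≤ (Δ + 1) ^ n := by
  classical
  induction n with
  | zero =>
    refine ⟨{e}, fun v => ?_, by simp⟩
    rw [Finset.mem_singleton, Nat.le_zero, hconn.dist_eq_zero_iff, eq_comm]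
  | succ n ih =>
    obtain ⟨s, hs, hcard⟩ := ih
    let t : Finset V := s.biUnion fun u => insert u (hlf u).toFinset
    have hsub : ∀ v, G.dist e v ≤ n + 1 → v ∈ t := by
      intro v hv
      rw [Finset.mem_biUnion]
      rcases Nat.lt_or_ge n (G.dist e v) with hlt | hge
      · obtain ⟨u, hu, hd⟩ := exists_adj_dist hconn (le_antisymm hv hlt)
        exact ⟨u, (hs u).2 hd.le, by simp [hu.symm]⟩
      · exact ⟨v, (hs v).2 hge, by simp⟩
    refine ⟨t.filter fun v => G.dist e v ≤ n + 1, fun v => ?_, ?_⟩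
    · rw [Finset.mem_filter]
      exact ⟨fun h => h.2, fun h => ⟨hsub v h, h⟩⟩
    · refine (Finset.card_filter_le _ _).trans ?_
      refine (Finset.card_biUnion_le_card_mul s _ (Δ + 1) fun u _ => ?_).trans ?_
      · refine (Finset.card_insert_le _ _).trans (Nat.succ_le_succ (hΔ u _ fun w hw => ?_))
        simpa using hw
      · rw [pow_succ]
        exact Nat.mul_le_mul_right _ hcard

theorem finite_ball {G : SimpleGraph V} (hconn : G.Connected)
    (hlf : ∀ v : V, (G.neighborSet v).Finite) (e : V) (n : ℕ) :
    {v | G.dist e v ≤ n}.Finite := by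
  induction n with
  | zero =>
    refine (Set.finite_singleton e).subset fun v hv => ?_
    exact (hconn.dist_eq_zero_iff.1 (Nat.le_zero.1 hv)).symm
  | succ n ih =>
    refine (ih.union (ih.biUnion fun u _ => hlf u)).subset fun v hv => ?_
    rcases Nat.lt_or_ge n (G.dist e v) with hlt | hge
    · obtain ⟨u, hu, hd⟩ := exists_adj_dist hconn (le_antisymm hv hlt)
      exact Or.inr (Set.mem_biUnion (x := u) hd.le hu.symm)
    · exact Or.inl hge

theorem countable_of_connected {G : SimpleGraph V} (hconn : G.Connected)
    (hlf : ∀ v : V, (G.neighborSet v).Finite) : Countable V := by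
  obtain ⟨e⟩ := hconn.nonempty
  rw [← Set.countable_univ_iff]
  refine (Set.countable_iUnion fun n => (finite_ball hconn hlf e n).countable).mono fun v _ => ?_
  exact Set.mem_iUnion.2 ⟨G.dist e v, le_refl (G.dist e v)⟩

end Growth

/-! ### The Floyd metric -/

section FloydMetric

variable {V : Type*}

/-- A Floyd function need not be monotone at `0`; it is dominated by a summable antitone
function. -/
theorem IsFloydFunction.exists_antitone_majorant {f : ℕ → ℝ≥0} (hf : IsFloydFunction f) :
    ∃ F : ℕ → ℝ≥0, Antitone F ∧ Summable F ∧ ∀ n, f n ≤ F n := by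
  refine ⟨fun n => if n = 0 then max (f 0) (f 1) else f n, antitone_nat_of_succ_le fun n => ?_,
    ?_, fun n => ?_⟩
  · rcases Nat.eq_zero_or_pos n with rfl | hn
    · simp
    · simpa [hn.ne'] using hf.antitone n hn
  · rw [← NNReal.summable_nat_add_iff 1]
    simpa using (NNReal.summable_nat_add_iff 1).2 hf.summable
  · rcases Nat.eq_zero_or_pos n with rfl | hn
    · simp
    · simp [hn.ne']

theorem floydDist_le_edgeLength {G : SimpleGraph V} (e : V) (f : ℕ → ℝ≥0) {v w : V}
    (h : G.Adj v w) : floydDist G e f v w ≤ edgeLength G e f v w :=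
  (iInf_le _ (SimpleGraph.Walk.cons h SimpleGraph.Walk.nil)).trans
    (by simp [floydLength])

/-- A walk of length `k` from a vertex `v` stays at distance at least `|v| - k` from the base
vertex, so each of its edges has length at most `F (|v| - k)`. -/
theorem floydDist_le_of_walk {G : SimpleGraph V} (hconn : G.Connected) (e : V) {f F : ℕ → ℝ≥0}
    (hF : Antitone F) (hfF : ∀ n, f n ≤ F n) {v w : V} (p : G.Walk v w) (R : ℕ)
    (hR : R + p.length ≤ G.dist e v) :
    floydDist G e f v w ≤ (p.length : ℝ≥0∞) * F R := by
  induction p with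
  | nil => simp [floydDist_self]
  | cons h q ih =>
    rename_i u x y
    rw [SimpleGraph.Walk.length_cons] at hR ⊢
    have hd := hconn.dist_triangle (u := e) (v := x) (w := u)
    have h1 : G.dist x u = 1 := SimpleGraph.dist_eq_one_iff_adj.2 h.symm
    have hedge : edgeLength G e f u x ≤ F R := (hfF _).trans (hF (le_min (by omega) (by omega)))
    calc floydDist G e f u y ≤ floydDist G e f u x + floydDist G e f x y :=
          floydDist_triangle G e f u x y
      _ ≤ F R + q.length * F R := by
          refine add_le_add ((floydDist_le_edgeLength e f h).trans (by exact_mod_cast hedge))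
            (ih (by omega))
      _ = ((q.length + 1 : ℕ) : ℝ≥0∞) * F R := by push_cast; ring

theorem floydDist_le_dist_mul {G : SimpleGraph V} (hconn : G.Connected) (e : V) {f F : ℕ → ℝ≥0}
    (hF : Antitone F) (hfF : ∀ n, f n ≤ F n) {v w : V} {R : ℕ}
    (hR : R + G.dist v w ≤ G.dist e v) :
    floydDist G e f v w ≤ (G.dist v w : ℝ≥0∞) * F R := by
  obtain ⟨p, hp⟩ := hconn.exists_walk_length_eq_dist v w
  rw [← hp] at hR ⊢
  exact floydDist_le_of_walk hconn e hF hfF p R hR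

/-- Following a geodesic towards the base vertex, a vertex at distance `R + k` is connected to the
sphere of radius `R` by a path of Floyd length at most `F(R) + ⋯ + F(R+k-1)`. -/
theorem exists_dist_eq_floydDist_le {G : SimpleGraph V} (hconn : G.Connected) (e : V)
    {f F : ℕ → ℝ≥0} (hfF : ∀ n, f n ≤ F n) (R k : ℕ) {v : V} (hv : G.dist e v = R + k) :
    ∃ u, G.dist e u = R ∧
      floydDist G e f v u ≤ ((∑ i ∈ Finset.range k, F (R + i) : ℝ≥0) : ℝ≥0∞) := by
  induction k generalizing v with
  | zero => exact ⟨v, hv, by simp [floydDist_self]⟩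
  | succ k ih =>
    obtain ⟨x, hx, hxd⟩ := exists_adj_dist hconn (e := e) (v := v) (n := R + k) (by omega)
    obtain ⟨u, hu, hle⟩ := ih hxd
    refine ⟨u, hu, (floydDist_triangle G e f v x u).trans ?_⟩
    rw [Finset.sum_range_succ, ENNReal.coe_add, add_comm]
    refine add_le_add hle ((floydDist_le_edgeLength e f hx).trans ?_)
    have : edgeLength G e f v x = f (R + k) := by
      rw [edgeLength, hv, hxd, min_eq_right (by omega)]
    rw [this]
    exact_mod_cast hfF _

/-- The Floyd metric is bounded. -/
theorem floydDist_le_diam {G : SimpleGraph V} (hconn : G.Connected) (e : V) {f F : ℕ → ℝ≥0}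
    (hFs : Summable F) (hfF : ∀ n, f n ≤ F n) (v w : V) :
    floydDist G e f v w ≤ ((2 * ∑' n, F n : ℝ≥0) : ℝ≥0∞) := by
  have key : ∀ v, floydDist G e f v e ≤ ((∑' n, F n : ℝ≥0) : ℝ≥0∞) := by
    intro v
    obtain ⟨u, hu, hle⟩ :=
      exists_dist_eq_floydDist_le hconn e hfF 0 (G.dist e v) (zero_add (G.dist e v)).symm
    rw [hconn.dist_eq_zero_iff] at hu
    subst hu
    refine hle.trans (ENNReal.coe_le_coe.2 ?_)
    simpa using hFs.sum_le_tsum (Finset.range (G.dist e v)) (fun _ _ => zero_le)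
  calc floydDist G e f v w ≤ floydDist G e f v e + floydDist G e f e w :=
        floydDist_triangle G e f v e w
    _ ≤ _ := by
        rw [two_mul, ENNReal.coe_add]
        exact add_le_add (key v) ((floydDist_comm_le G e f e w).trans (key w))

/-- Vertices are isolated in the Floyd metric: every path leaving `v` starts with an edge whose
length is one of `f 0, …, f |v|`. -/
theorem exists_pos_le_floydDist (G : SimpleGraph V) (e : V) {f : ℕ → ℝ≥0}
    (hf : ∀ n, 0 < f n) (v : V) :
    ∃ c : ℝ≥0, 0 < c ∧ ∀ w, w ≠ v → (c : ℝ≥0∞) ≤ floydDist G e f v w := by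
  obtain ⟨i, -, hi⟩ := Finset.exists_min_image (Finset.range (G.dist e v + 1)) f ⟨0, by simp⟩
  refine ⟨f i, hf i, fun w hw => le_iInf fun p => ?_⟩
  cases p with
  | nil => exact absurd rfl hw
  | cons h q =>
    rename_i u
    rw [ENNReal.coe_le_coe]
    refine (hi (min (G.dist e v) (G.dist e u)) ?_).trans ?_
    · rw [Finset.mem_range, Nat.lt_succ_iff]
      exact min_le_left _ _
    · simp [floydLength, edgeLength]

/-- The vertex set is totally bounded in the Floyd metric: it lies in a small neighbourhood of a
sphere together with the ball that it bounds. -/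
theorem totallyBounded_floydSpace {G : SimpleGraph V} (hconn : G.Connected)
    (hlf : ∀ v : V, (G.neighborSet v).Finite) (e : V) {f F : ℕ → ℝ≥0} (hFs : Summable F)
    (hfF : ∀ n, f n ≤ F n) : TotallyBounded (Set.univ : Set (FloydSpace G e f)) := by
  rw [EMetric.totallyBounded_iff]
  intro ε hε
  have htail : Tendsto (fun R => ((∑' i, F (i + R) : ℝ≥0) : ℝ≥0∞)) atTop (𝓝 0) := by
    simpa only [ENNReal.coe_zero] using ENNReal.tendsto_coe.2 (NNReal.tendsto_sum_nat_add F)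
  obtain ⟨R, hR⟩ := ((tendsto_order.1 htail).2 ε hε).exists
  refine ⟨{v : V | G.dist e v ≤ R}, finite_ball hconn hlf e R, fun v _ => ?_⟩
  rw [Set.mem_iUnion₂]
  change ∃ (u : V) (_ : G.dist e u ≤ R), floydDist G e f v u < ε
  rcases le_total (G.dist e v) R with hle | hge
  · exact ⟨v, hle, (floydDist_self G e f v).trans_lt hε⟩
  · obtain ⟨k, hk⟩ := Nat.exists_eq_add_of_le hge
    obtain ⟨u, hu, hd⟩ := exists_dist_eq_floydDist_le hconn e hfF R k hk
    refine ⟨u, hu.le, (hd.trans (ENNReal.coe_le_coe.2 ?_)).trans_lt hR⟩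
    have hs : Summable fun i => F (i + R) := (NNReal.summable_nat_add_iff R).2 hFs
    simpa only [add_comm] using hs.sum_le_tsum (Finset.range k) (fun _ _ => zero_le)

end FloydMetric

/-! ### The Floyd compactification -/

section Completion

variable {V : Type*} {G : SimpleGraph V} {e : V} {f : ℕ → ℝ≥0}

theorem compactSpace_floydCompletion
    (h : TotallyBounded (Set.univ : Set (FloydSpace G e f))) :
    CompactSpace (FloydCompletion G e f) := by
  rw [← isCompact_univ_iff]
  refine TotallyBounded.isCompact_of_isClosed ?_ isClosed_univ
  have := (h.image (UniformSpace.Completion.uniformContinuous_coe (FloydSpace G e f))).closure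
  rwa [Set.image_univ, UniformSpace.Completion.denseRange_coe.closure_range] at this

theorem pseudoMetrizableSpace_floydCompletion (h : ∀ v w, floydDist G e f v w ≠ ∞) :
    TopologicalSpace.PseudoMetrizableSpace (FloydCompletion G e f) := by
  let m : PseudoMetricSpace (FloydSpace G e f) := PseudoEMetricSpace.toPseudoMetricSpace h
  exact (inferInstance : TopologicalSpace.PseudoMetrizableSpace
    (@UniformSpace.Completion (FloydSpace G e f) m.toUniformSpace))

theorem isOpen_singleton_toCompletion (hf : ∀ n, 0 < f n) (v : V) :
    IsOpen {toCompletion G e f v} := by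
  obtain ⟨c, hc, hcv⟩ := exists_pos_le_floydDist G e hf v
  have hopen : IsOpen ({v} : Set (FloydSpace G e f)) := by
    rw [EMetric.isOpen_iff]
    intro x hx
    obtain rfl : x = v := hx
    refine ⟨c, by exact_mod_cast hc, fun w hw => ?_⟩
    by_contra hne
    have hlt : floydDist G e f w x < c := hw
    exact absurd ((floydDist_comm_le G e f x w).trans_lt hlt) (not_lt.2 (hcv w hne))
  obtain ⟨U, hU, hUv⟩ :=
    (UniformSpace.Completion.isUniformInducing_coe (FloydSpace G e f)).isInducing.isOpen_iff.1 hopen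
  have hvU : toCompletion G e f v ∈ U := by
    have : (v : FloydSpace G e f) ∈ ({v} : Set (FloydSpace G e f)) := rfl
    rw [← hUv] at this
    exact this
  suffices U = {toCompletion G e f v} by rwa [← this]
  refine Set.Subset.antisymm (fun x hx => ?_) (Set.singleton_subset_iff.2 hvU)
  by_contra hne
  obtain ⟨w, hwU, hwne⟩ :=
    (UniformSpace.Completion.denseRange_coe (α := FloydSpace G e f)).exists_mem_open
      (hU.sdiff isClosed_singleton) ⟨x, hx, hne⟩ |>.imp fun w hw => hw
  have hw : w ∈ ({v} : Set (FloydSpace G e f)) := by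
    rw [← hUv]
    exact hwU
  exact hwne (congrArg _ hw)

theorem toCompletion_injective (hf : ∀ n, 0 < f n) :
    Function.Injective (toCompletion G e f) := by
  intro v w h
  by_contra hne
  obtain ⟨c, hc, hcv⟩ := exists_pos_le_floydDist G e hf v
  have hins : @Inseparable (FloydSpace G e f) _ v w :=
    (UniformSpace.Completion.isUniformInducing_coe (FloydSpace G e f)).isInducing.inseparable_iff.1
      (.of_eq h)
  have h0 : floydDist G e f v w = 0 := EMetric.inseparable_iff.1 hins
  have := hcv w (Ne.symm hne)
  rw [h0, nonpos_iff_eq_zero] at this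
  exact hc.ne' (by exact_mod_cast this)

theorem isClosed_floydBoundary (hf : ∀ n, 0 < f n) : IsClosed (floydBoundary G e f) := by
  rw [floydBoundary, isClosed_compl_iff, ← Set.iUnion_singleton_eq_range]
  exact isOpen_iUnion fun v => isOpen_singleton_toCompletion hf v

/-- Near a boundary point there are only vertices far from the base vertex. -/
theorem vertexNhds_le_atInfinity (hconn : G.Connected)
    (hlf : ∀ v : V, (G.neighborSet v).Finite) (ξ : floydBoundary G e f) :
    vertexNhds G e f ξ ≤ atInfinity G e := by
  intro s hs
  obtain ⟨R, hR⟩ := eventually_atInfinity.1 hs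
  refine ⟨(toCompletion G e f '' {v | G.dist e v ≤ R})ᶜ,
    ((finite_ball hconn hlf e R).image _).isClosed.isOpen_compl.mem_nhds ?_, fun v hv => ?_⟩
  · rintro ⟨v, -, hv⟩
    exact ξ.2 ⟨v, hv⟩
  · refine hR v ?_
    by_contra hlt
    exact hv ⟨v, (not_le.1 hlt).le, rfl⟩

/-- A real function on the vertices that is asymptotic, at infinity, to the restriction of a
continuous function `g` on the Floyd compactification extends continuously by `g` on the
boundary. -/
theorem exists_continuous_extension (hf : ∀ n, 0 < f n) (hconn : G.Connected)
    (hlf : ∀ v : V, (G.neighborSet v).Finite) (g : C(FloydCompletion G e f, ℝ)) (h : V → ℝ)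
    (hgh : Tendsto (fun v => h v - g (toCompletion G e f v)) (atInfinity G e) (𝓝 0)) :
    ∃ H : C(FloydCompletion G e f, ℝ), (∀ v, H (toCompletion G e f v) = h v) ∧
      ∀ ξ : floydBoundary G e f, H ξ = g ξ := by
  classical
  -- The difference to `g`, extended by `0`: continuous at the vertices because they are isolated,
  -- and at the boundary because it vanishes at infinity.
  let k : FloydCompletion G e f → ℝ :=
    Function.extend (toCompletion G e f) (fun v => h v - g (toCompletion G e f v)) 0
  have hkv : ∀ v, k (toCompletion G e f v) = h v - g (toCompletion G e f v) := fun v =>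
    (toCompletion_injective hf).extend_apply _ _ v
  have hkξ : ∀ x ∈ floydBoundary G e f, k x = 0 := fun x hx => Function.extend_apply' _ _ x hx
  have hk : Continuous k := by
    rw [continuous_iff_continuousAt]
    intro x
    by_cases hx : x ∈ floydBoundary G e f
    · rw [ContinuousAt, hkξ x hx, Metric.tendsto_nhds]
      intro ε hε
      have hv := vertexNhds_le_atInfinity hconn hlf ⟨x, hx⟩ (Metric.tendsto_nhds.1 hgh ε hε)
      rw [vertexNhds, mem_comap] at hv
      obtain ⟨t, ht, hts⟩ := hv
      filter_upwards [ht] with y hy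
      by_cases hyb : y ∈ floydBoundary G e f
      · rwa [hkξ y hyb, dist_self]
      · obtain ⟨v, rfl⟩ := not_not.1 hyb
        rw [hkv]
        exact hts hy
    · obtain ⟨v, rfl⟩ := not_not.1 hx
      rw [ContinuousAt,
        (isOpen_singleton_iff_nhds_eq_pure _).1 (isOpen_singleton_toCompletion hf v)]
      exact tendsto_pure_nhds _ _
  refine ⟨⟨fun x => g x + k x, g.continuous.add hk⟩, fun v => ?_, fun ξ => ?_⟩
  · simp [hkv]
  · simp [hkξ ξ ξ.2]

/-- Uniform continuity of `g` on the vertices, in the form of a modulus of continuity that is linear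
up to an arbitrarily small error. -/
theorem exists_edist_le_add_mul [CompactSpace (FloydCompletion G e f)]
    (g : C(FloydCompletion G e f, ℝ)) {ε : ℝ≥0∞} (hε : 0 < ε) :
    ∃ c : ℝ≥0∞, c ≠ ∞ ∧ ∀ v w : V,
      edist (g (toCompletion G e f v)) (g (toCompletion G e f w)) ≤
        ε + c * floydDist G e f v w := by
  have huc : UniformContinuous fun v : FloydSpace G e f => g v :=
    (CompactSpace.uniformContinuous_of_continuous g.continuous).comp
      (UniformSpace.Completion.uniformContinuous_coe _)
  obtain ⟨δ, hδ, hδt, hδg⟩ : ∃ δ : ℝ≥0∞, δ ≠ 0 ∧ δ ≠ ∞ ∧ ∀ v w : V, floydDist G e f v w < δ →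
      edist (g (toCompletion G e f v)) (g (toCompletion G e f w)) < ε := by
    obtain ⟨δ, hδ, hδg⟩ := EMetric.uniformContinuous_iff.1 huc ε hε
    exact ⟨min δ 1, (lt_min hδ one_pos).ne', ((min_le_right _ _).trans_lt ENNReal.one_lt_top).ne,
      fun v w h => hδg (a := v) (b := w) (h.trans_le (min_le_left _ _))⟩
  refine ⟨ENNReal.ofReal (2 * ‖g‖) / δ, ENNReal.div_ne_top ENNReal.ofReal_ne_top hδ,
    fun v w => ?_⟩
  rcases lt_or_ge (floydDist G e f v w) δ with hlt | hge
  · exact (hδg v w hlt).le.trans le_self_add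
  · refine le_trans ?_ le_add_self
    calc edist (g (toCompletion G e f v)) (g (toCompletion G e f w))
        ≤ ENNReal.ofReal (2 * ‖g‖) := by
          rw [edist_dist]
          exact ENNReal.ofReal_le_ofReal (g.dist_le_two_norm _ _)
      _ = ENNReal.ofReal (2 * ‖g‖) / δ * δ := (ENNReal.div_mul_cancel hδ hδt).symm
      _ ≤ _ := mul_le_mul_right hge _

end Completion

/-! ### The expected Floyd length of a trajectory -/

section TotalLength

variable {V : Type*}

theorem tsum_comp_div (a : ℕ → ℝ≥0∞) (q : ℕ) [NeZero q] :
    ∑' n, a (n / q) = q * ∑' n, a n := by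
  rw [← (Nat.divModEquiv q).symm.tsum_eq, ENNReal.tsum_prod', ← ENNReal.tsum_mul_left]
  refine tsum_congr fun m => ?_
  rw [tsum_fintype, Finset.sum_congr rfl (g := fun _ => a m)]
  · simp
  · intro i _
    congr 1
    have hq : 0 < q := Nat.pos_of_ne_zero (NeZero.ne q)
    simp [Nat.divModEquiv, Nat.add_div_of_dvd_right, Nat.mul_div_cancel _ hq]

theorem stepTail_antitone (G : SimpleGraph V) (P : V → PMF V) : Antitone (stepTail G P) :=
  fun _ _ h => iSup_mono fun _ => measure_mono (Set.Ici_subset_Ici.2 h)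

/-- `E_v d_f(Z_0, Z_1)`, the expected Floyd length of one step from `v`. -/
def stepFloydLength (G : SimpleGraph V) (e : V) (f : ℕ → ℝ≥0) (P : V → PMF V) (v : V) : ℝ≥0∞ :=
  ∑' u, P v u * floydDist G e f v u

/-- `E_v ∑_n d_f(Z_n, Z_{n+1})`, the expected Floyd length of the trajectory from `v`. -/
def totalFloydLength (G : SimpleGraph V) (e : V) (f : ℕ → ℝ≥0) (P : V → PMF V) (v : V) : ℝ≥0∞ :=
  ∑' n, evolve P n (stepFloydLength G e f P) v

/-- A bound, in terms of `m = |v|`, for the expected Floyd length of a step from `v`: steps of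
length at most `m / 2` stay where edges have length at most `F (m / 2)`, and longer steps, which are
improbable, have Floyd length at most the diameter. -/
def stepBound (G : SimpleGraph V) (F : ℕ → ℝ≥0) (P : V → PMF V) (m : ℕ) : ℝ≥0∞ :=
  (∑' n : ℕ, stepTail G P (n + 1)) * F (m / 2) +
    stepTail G P (m / 2 + 1) * ((2 * ∑' n, F n : ℝ≥0) : ℝ≥0∞)

theorem stepFloydLength_le {G : SimpleGraph V} (hconn : G.Connected) (e : V) {f F : ℕ → ℝ≥0}
    (hF : Antitone F) (hFs : Summable F) (hfF : ∀ n, f n ≤ F n) (P : V → PMF V) (v : V) :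
    stepFloydLength G e f P v ≤ stepBound G F P (G.dist e v) := by
  set R := G.dist e v / 2 with hR
  set D : ℝ≥0∞ := ((2 * ∑' n, F n : ℝ≥0) : ℝ≥0∞) with hD
  have hpt : ∀ u, floydDist G e f v u ≤
      G.dist v u * F R + (if R + 1 ≤ G.dist v u then 1 else 0) * D := by
    intro u
    by_cases hu : R + 1 ≤ G.dist v u
    · rw [if_pos hu, one_mul]
      exact (floydDist_le_diam hconn e hFs hfF v u).trans le_add_self
    · exact (floydDist_le_dist_mul hconn e hF hfF (by omega)).trans le_self_add
  calc stepFloydLength G e f P v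
      ≤ ∑' u, P v u * (G.dist v u * F R + (if R + 1 ≤ G.dist v u then 1 else 0) * D) :=
        ENNReal.tsum_le_tsum fun u => mul_le_mul_right (hpt u) _
    _ = (∑' u, P v u * G.dist v u) * F R +
          (∑' u, P v u * (if R + 1 ≤ G.dist v u then 1 else 0)) * D := by
        simp_rw [mul_add, ← mul_assoc]
        rw [ENNReal.tsum_add, ENNReal.tsum_mul_right, ENNReal.tsum_mul_right]
    _ ≤ _ := add_le_add (mul_le_mul_left (tsum_step_dist_le G P v) _)
        (mul_le_mul_left (tsum_step_tail_le G P v (R + 1)) _)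

theorem stepBound_antitone {G : SimpleGraph V} {F : ℕ → ℝ≥0} (hF : Antitone F) (P : V → PMF V) :
    Antitone (stepBound G F P) := by
  intro m n h
  have h2 : m / 2 ≤ n / 2 := Nat.div_le_div_right h
  exact add_le_add (mul_le_mul_right (ENNReal.coe_le_coe.2 (hF h2)) _)
    (mul_le_mul_left (stepTail_antitone G P (Nat.succ_le_succ h2)) _)

theorem tsum_stepBound_ne_top {G : SimpleGraph V} {F : ℕ → ℝ≥0} (hFs : Summable F) {P : V → PMF V}
    (hmom : UniformFirstMoment G P) : ∑' m, stepBound G F P m ≠ ∞ := by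
  unfold stepBound
  rw [ENNReal.tsum_add, ENNReal.tsum_mul_left, ENNReal.tsum_mul_right,
    tsum_comp_div (fun m => (F m : ℝ≥0∞)), tsum_comp_div (fun m => stepTail G P (m + 1))]
  refine ENNReal.add_ne_top.2 ⟨ENNReal.mul_ne_top hmom.ne (ENNReal.mul_ne_top (by simp) ?_),
    ENNReal.mul_ne_top (ENNReal.mul_ne_top (by simp) hmom.ne) ENNReal.coe_ne_top⟩
  exact ENNReal.tsum_coe_ne_top_iff_summable.2 hFs

/-- The walk escapes at a linear rate, uniformly in the starting point. If balls have at most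
`A^n` elements and `p^(n) ≤ C ρ^n`, then for `q` with `A ρ^q < 1` the probability that
`|Z_n| ≤ n / q` decays exponentially; so `E_v Ψ(|Z_n|)` is summable for summable antitone `Ψ`. -/
theorem exists_summable_bound_evolve {G : SimpleGraph V} {e : V} {P : V → PMF V} {A : ℕ}
    (hball : ∀ n, ∃ s : Finset V, (∀ v, v ∈ s ↔ G.dist e v ≤ n) ∧ s.card ≤ A ^ n)
    {ρ : ℝ≥0∞} (hρ : ρ < 1) {C : ℝ≥0} (hdecay : ∀ (n : ℕ) (v w : V), nStep P n v w ≤ C * ρ ^ n)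
    {Ψ : ℕ → ℝ≥0∞} (hΨ : Antitone Ψ) (hΨs : ∑' n, Ψ n ≠ ∞) :
    ∃ b : ℕ → ℝ≥0∞, ∑' n, b n ≠ ∞ ∧ ∀ n v, evolve P n (fun w => Ψ (G.dist e w)) v ≤ b n := by
  have hpow : Tendsto (fun q : ℕ => (A : ℝ≥0∞) * ρ ^ q) atTop (𝓝 0) := by
    simpa using ENNReal.Tendsto.const_mul (ENNReal.tendsto_pow_atTop_nhds_zero_of_lt_one hρ)
      (Or.inr (ENNReal.natCast_ne_top A))
  obtain ⟨q, hq, hr⟩ :=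
    ((eventually_ge_atTop 1).and ((tendsto_order.1 hpow).2 1 one_pos)).exists
  have : NeZero q := ⟨by omega⟩
  set r : ℝ≥0∞ := A * ρ ^ q
  refine ⟨fun n => Ψ (n / q) + C * r ^ (n / q) * Ψ 0, ?_, fun n v => ?_⟩
  · rw [ENNReal.tsum_add, tsum_comp_div, tsum_comp_div (fun n => C * r ^ n * Ψ 0),
      ENNReal.tsum_mul_right, ENNReal.tsum_mul_left, ENNReal.tsum_geometric]
    have h1 : (1 - r)⁻¹ ≠ ∞ := ENNReal.inv_ne_top.2 (tsub_pos_of_lt hr).ne'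
    exact ENNReal.add_ne_top.2 ⟨ENNReal.mul_ne_top (by simp) hΨs, ENNReal.mul_ne_top (by simp)
      (ENNReal.mul_ne_top (ENNReal.mul_ne_top ENNReal.coe_ne_top h1)
        (ENNReal.ne_top_of_tsum_ne_top hΨs 0))⟩
  · classical
    obtain ⟨s, hs, hcard⟩ := hball (n / q)
    have hpt : ∀ w, Ψ (G.dist e w) ≤ Ψ (n / q) + (if w ∈ s then 1 else 0) * Ψ 0 := by
      intro w
      by_cases hw : w ∈ s
      · rw [if_pos hw, one_mul]
        exact (hΨ (Nat.zero_le _)).trans le_add_self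
      · rw [hs, not_le] at hw
        exact (hΨ hw.le).trans le_self_add
    have hmass : ∑' w, nStep P n v w * (if w ∈ s then 1 else 0) ≤ C * r ^ (n / q) := by
      calc ∑' w, nStep P n v w * (if w ∈ s then 1 else 0)
          = ∑ w ∈ s, nStep P n v w * (if w ∈ s then 1 else 0) :=
            tsum_eq_sum fun w hw => by rw [if_neg hw, mul_zero]
        _ ≤ ∑ w ∈ s, C * ρ ^ n := by
            refine Finset.sum_le_sum fun w hw => ?_
            rw [if_pos hw, mul_one]
            exact hdecay n v w
        _ = s.card * (C * ρ ^ n) := by simp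
        _ ≤ (A : ℝ≥0∞) ^ (n / q) * (C * (ρ ^ q) ^ (n / q)) := by
            refine mul_le_mul' (by exact_mod_cast hcard) (mul_le_mul_right ?_ _)
            rw [← pow_mul]
            exact pow_le_pow_right_of_le_one' hρ.le (Nat.mul_div_le n q)
        _ = C * r ^ (n / q) := by rw [mul_pow]; ring
    calc evolve P n (fun w => Ψ (G.dist e w)) v
        ≤ ∑' w, nStep P n v w * (Ψ (n / q) + (if w ∈ s then 1 else 0) * Ψ 0) :=
          ENNReal.tsum_le_tsum fun w => mul_le_mul_right (hpt w) _
      _ = Ψ (n / q) + (∑' w, nStep P n v w * (if w ∈ s then 1 else 0)) * Ψ 0 := by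
          simp_rw [mul_add, ← mul_assoc]
          rw [ENNReal.tsum_add, ENNReal.tsum_mul_right, ENNReal.tsum_mul_right, PMF.tsum_coe,
            one_mul]
      _ ≤ _ := add_le_add le_rfl (mul_le_mul_left hmass _)

/-- The expected Floyd length of the trajectory from `v` is finite and tends to `0` as `v` tends to
infinity. The terms of the series tend to `0` and are dominated by a summable sequence which does
not depend on `v`. -/
theorem totalFloydLength_ne_top_and_tendsto {G : SimpleGraph V} (hconn : G.Connected)
    (hlf : ∀ v : V, (G.neighborSet v).Finite) (e : V) {P : V → PMF V}
    (hirr : UniformlyIrreducible G P) (hmom : UniformFirstMoment G P) {ρ : ℝ≥0∞} (hρ : ρ < 1)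
    {C : ℝ≥0} (hdecay : ∀ (n : ℕ) (v w : V), nStep P n v w ≤ C * ρ ^ n) {f : ℕ → ℝ≥0}
    (hf : IsFloydFunction f) :
    (∀ v, totalFloydLength G e f P v ≠ ∞) ∧
      Tendsto (totalFloydLength G e f P) (atInfinity G e) (𝓝 0) := by
  obtain ⟨F, hF, hFs, hfF⟩ := hf.exists_antitone_majorant
  obtain ⟨Δ, hΔ⟩ := hirr.exists_degree_bound
  have hΨ := stepBound_antitone (G := G) hF P
  have hΨs := tsum_stepBound_ne_top hFs hmom
  obtain ⟨b, hb, hbound⟩ := exists_summable_bound_evolve (exists_ball_finset hconn e hlf hΔ) hρ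
    hdecay hΨ hΨs
  have hstep := stepFloydLength_le hconn e hF hFs hfF P
  have hle : ∀ n v, evolve P n (stepFloydLength G e f P) v ≤ b n := fun n v =>
    (evolve_mono P n hstep v).trans (hbound n v)
  refine ⟨fun v => ((ENNReal.tsum_le_tsum fun n => hle n v).trans_lt (lt_top_iff_ne_top.2 hb)).ne,
    ?_⟩
  have hlim : Tendsto (stepFloydLength G e f P) (atInfinity G e) (𝓝 0) :=
    tendsto_of_tendsto_of_tendsto_of_le_of_le tendsto_const_nhds
      ((ENNReal.tendsto_atTop_zero_of_tsum_ne_top hΨs).comp tendsto_comap)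
      (fun _ => zero_le) hstep
  have hterm := tendsto_evolve hconn hmom.tendsto_stepTail (ENNReal.ne_top_of_tsum_ne_top hΨs 0)
    (fun v => (hstep v).trans (hΨ (Nat.zero_le _))) hlim
  have hdom := tendsto_lintegral_filter_of_dominated_convergence (μ := Measure.count)
    (l := atInfinity G e) (F := fun v n => evolve P n (stepFloydLength G e f P) v) (f := fun _ => 0)
    b (Eventually.of_forall fun _ => Measurable.of_discrete)
    (Eventually.of_forall fun v => ae_of_all _ fun n => hle n v) (by rwa [lintegral_count])
    (ae_of_all _ hterm)
  simp only [lintegral_count, lintegral_zero] at hdom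
  exact hdom

end TotalLength

/-! ### Convergence to the boundary -/

section Boundary

variable {V : Type*} [MeasurableSpace V] [DiscreteMeasurableSpace V]
variable {G : SimpleGraph V} {e : V} {f : ℕ → ℝ≥0} {P : V → PMF V}

theorem measurable_toCompletion_eval (G : SimpleGraph V) (e : V) (f : ℕ → ℝ≥0) (n : ℕ) :
    Measurable fun z : ℕ → V => toCompletion G e f (z n) :=
  (Measurable.of_discrete (f := toCompletion G e f)).comp (measurable_pi_apply n)

variable {L : (ℕ → V) → floydBoundary G e f}

theorem IsBoundaryLimit.measurable_coe (hL : IsBoundaryLimit G e f P L) :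
    Measurable fun z => (L z : FloydCompletion G e f) :=
  measurable_subtype_coe.comp hL.measurable

/-- `E_v g(Z_∞)`, for a continuous function `g` on the Floyd compactification. -/
def boundaryMean (P : V → PMF V) (L : (ℕ → V) → floydBoundary G e f)
    (g : C(FloydCompletion G e f, ℝ)) (v : V) : ℝ :=
  ∫ z, g (L z) ∂pathMeasure P v

theorem norm_boundaryMean_le [CompactSpace (FloydCompletion G e f)] (P : V → PMF V)
    (L : (ℕ → V) → floydBoundary G e f) (g : C(FloydCompletion G e f, ℝ)) (v : V) :
    ‖boundaryMean P L g v‖ ≤ ‖g‖ := by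
  refine (norm_integral_le_of_norm_le_const (ae_of_all _ fun z => g.norm_coe_le_norm (L z))).trans
    (le_of_eq ?_)
  simp

theorem IsBoundaryLimit.tendsto_integral [CompactSpace (FloydCompletion G e f)]
    (hL : IsBoundaryLimit G e f P L)
    (g : C(FloydCompletion G e f, ℝ)) (v : V) :
    Tendsto (fun n => ∫ z, g (toCompletion G e f (z n)) ∂pathMeasure P v) atTop
      (𝓝 (boundaryMean P L g v)) := by
  refine tendsto_integral_of_dominated_convergence (fun _ => ‖g‖) (fun n => ?_)
    (integrable_const _) (fun n => ae_of_all _ fun z => g.norm_coe_le_norm _) ?_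
  · exact (g.continuous.measurable.comp
      (measurable_toCompletion_eval G e f n)).aestronglyMeasurable
  · filter_upwards [hL.ae_tendsto v] with z hz
    exact (g.continuous.tendsto _).comp hz

variable [Countable V]

theorem measurable_floydDist_eval (G : SimpleGraph V) (e : V) (f : ℕ → ℝ≥0) (m n : ℕ) :
    Measurable fun z : ℕ → V => floydDist G e f (z m) (z n) :=
  Measurable.comp (g := fun q : V × V => floydDist G e f q.1 q.2) (f := fun z : ℕ → V => (z m, z n))
    Measurable.of_discrete ((measurable_pi_apply m).prodMk (measurable_pi_apply n))

theorem lintegral_tsum_floydDist (v : V) :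
    ∫⁻ z, ∑' n, floydDist G e f (z n) (z (n + 1)) ∂pathMeasure P v =
      totalFloydLength G e f P v := by
  rw [lintegral_tsum fun n => (measurable_floydDist_eval G e f n (n + 1)).aemeasurable]
  refine tsum_congr fun n => ?_
  rw [lintegral_pathMeasure_succ P v n (floydDist G e f)]
  exact lintegral_pathMeasure P v n (stepFloydLength G e f P)

theorem ae_eventually_ne {ρ : ℝ≥0∞} (hρ : ρ < 1) {C : ℝ≥0}
    (hdecay : ∀ (n : ℕ) (v w : V), nStep P n v w ≤ C * ρ ^ n) (v x : V) :
    ∀ᵐ z ∂pathMeasure P v, ∀ᶠ n in atTop, z n ≠ x := by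
  refine ae_eventually_notMem (μ := pathMeasure P v) (s := fun n => {z : ℕ → V | z n = x}) ?_
  have hmeas : ∀ n, pathMeasure P v {z : ℕ → V | z n = x} = nStep P n v x := fun n => by
    rw [← PMF.toMeasure_apply_singleton (nStep P n v) x (measurableSet_singleton x),
      ← map_pathMeasure, Measure.map_apply (measurable_pi_apply n) (measurableSet_singleton x)]
    rfl
  simp_rw [hmeas]
  refine ((ENNReal.tsum_le_tsum fun n => hdecay n v x).trans_lt ?_).ne
  rw [ENNReal.tsum_mul_left, ENNReal.tsum_geometric]
  exact ENNReal.mul_lt_top ENNReal.coe_lt_top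
    (lt_top_iff_ne_top.2 (ENNReal.inv_ne_top.2 (tsub_pos_of_lt hρ).ne'))

/-- Trajectories of finite Floyd length converge in the completion, and the limit of a transient
trajectory is not a vertex because vertices are isolated. -/
theorem ae_exists_tendsto_floydBoundary (hf : ∀ n, 0 < f n) {ρ : ℝ≥0∞} (hρ : ρ < 1) {C : ℝ≥0}
    (hdecay : ∀ (n : ℕ) (v w : V), nStep P n v w ≤ C * ρ ^ n)
    (hU : ∀ v, totalFloydLength G e f P v ≠ ∞) (v : V) :
    ∀ᵐ z ∂pathMeasure P v, ∃ x ∈ floydBoundary G e f,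
      Tendsto (fun n => toCompletion G e f (z n)) atTop (𝓝 x) := by
  have hlen : ∀ᵐ z ∂pathMeasure P v, ∑' n, floydDist G e f (z n) (z (n + 1)) < ∞ :=
    ae_lt_top (Measurable.tsum fun n => measurable_floydDist_eval G e f n (n + 1))
      (by rw [lintegral_tsum_floydDist]; exact hU v)
  filter_upwards [hlen, ae_all_iff.2 (ae_eventually_ne hρ hdecay v)] with z hz htrans
  have hc : CauchySeq (fun n => (show FloydSpace G e f from z n)) :=
    cauchySeq_of_edist_le_of_tsum_ne_top
      (fun n => floydDist G e f (z n) (z (n + 1))) (fun _ => le_rfl) hz.ne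
  have hc' : CauchySeq fun n => toCompletion G e f (z n) :=
    (UniformSpace.Completion.uniformContinuous_coe (FloydSpace G e f)).comp_cauchySeq hc
  obtain ⟨x, hx⟩ := cauchySeq_tendsto_of_complete hc'
  refine ⟨x, ?_, hx⟩
  rintro ⟨w, rfl⟩
  have hev := hx.eventually ((isOpen_singleton_toCompletion hf w).mem_nhds rfl)
  obtain ⟨n, hn, hne⟩ := (hev.and (htrans w)).exists
  exact hne (toCompletion_injective hf hn)

theorem exists_isBoundaryLimit [Nonempty V] (hf : ∀ n, 0 < f n)
    (hfin : ∀ v w, floydDist G e f v w ≠ ∞)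
    (h : ∀ v, ∀ᵐ z ∂pathMeasure P v, ∃ x ∈ floydBoundary G e f,
      Tendsto (fun n => toCompletion G e f (z n)) atTop (𝓝 x)) :
    ∃ L : (ℕ → V) → floydBoundary G e f, IsBoundaryLimit G e f P L := by
  classical
  have := pseudoMetrizableSpace_floydCompletion hfin
  -- One measurable limit serves all starting points: `L` is built from the sum of the laws `ℙ_v`.
  obtain ⟨L₀, hL₀, hlim⟩ := measurable_limit_of_tendsto_metrizable_ae
    (μ := Measure.sum fun v => pathMeasure P v) (L := atTop)
    (f := fun n (z : ℕ → V) => toCompletion G e f (z n))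
    (fun n => (measurable_toCompletion_eval G e f n).aemeasurable)
    (Measure.ae_sum_iff.2 fun v => (h v).mono fun z ⟨x, _, hx⟩ => ⟨x, hx⟩)
  obtain ⟨v₀⟩ := ‹Nonempty V›
  obtain ⟨-, ξ₀, hξ₀, -⟩ := (h v₀).exists
  have hset : MeasurableSet (L₀ ⁻¹' floydBoundary G e f) :=
    hL₀ (isClosed_floydBoundary hf).measurableSet
  let L₁ : (ℕ → V) → FloydCompletion G e f := fun z =>
    if L₀ z ∈ floydBoundary G e f then L₀ z else ξ₀
  have hmem : ∀ z, L₁ z ∈ floydBoundary G e f := fun z => by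
    by_cases hz : L₀ z ∈ floydBoundary G e f
    · simpa only [L₁, if_pos hz] using hz
    · simpa only [L₁, if_neg hz] using hξ₀
  refine ⟨fun z => ⟨L₁ z, hmem z⟩, (Measurable.ite hset hL₀ measurable_const).subtype_mk,
    fun v => ?_⟩
  filter_upwards [h v, Measure.ae_sum_iff.1 hlim v] with z ⟨x, hx, hzx⟩ hz
  have heq : L₀ z = x := tendsto_nhds_unique hz hzx
  have : L₁ z = x := by simp only [L₁, heq, if_pos hx]
  simpa only [this] using hzx

variable [CompactSpace (FloydCompletion G e f)]

/-- `v ↦ E_v g(Z_∞)` is harmonic, as the limit of the functions `Pⁿ g`, which satisfy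
`P^{n+1} g = P (Pⁿ g)`. -/
theorem IsBoundaryLimit.hasSum_boundaryMean (hL : IsBoundaryLimit G e f P L)
    (g : C(FloydCompletion G e f, ℝ)) (v : V) :
    HasSum (fun w => (P v w).toReal * boundaryMean P L g w) (boundaryMean P L g v) := by
  have hint : Integrable (boundaryMean P L g) (P v).toMeasure :=
    Integrable.of_bound Measurable.of_discrete.aestronglyMeasurable ‖g‖
      (ae_of_all _ (norm_boundaryMean_le P L g))
  have h1 : Tendsto (fun n => ∫ u, ∫ z, g (toCompletion G e f (z n)) ∂pathMeasure P u
      ∂(P v).toMeasure) atTop (𝓝 (∫ u, boundaryMean P L g u ∂(P v).toMeasure)) := by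
    refine tendsto_integral_of_dominated_convergence (fun _ => ‖g‖)
      (fun n => Measurable.of_discrete.aestronglyMeasurable) (integrable_const _)
      (fun n => ae_of_all _ fun u => ?_) (ae_of_all _ fun u => hL.tendsto_integral g u)
    refine (norm_integral_le_of_norm_le_const
      (ae_of_all _ fun z => g.norm_coe_le_norm _)).trans (le_of_eq ?_)
    simp
  have h2 := (tendsto_add_atTop_iff_nat 1).2 (hL.tendsto_integral g v)
  simp_rw [integral_pathMeasure_succ P (fun w => g (toCompletion G e f w))
    (fun w => g.norm_coe_le_norm _)] at h2
  have heq := tendsto_nhds_unique h2 h1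
  rw [PMF.integral_eq_tsum _ _ hint] at heq
  rw [heq]
  refine Summable.hasSum (Summable.of_norm_bounded (g := fun w => (P v w).toReal * ‖g‖)
    ((ENNReal.summable_toReal (P v).tsum_coe_ne_top).mul_right _) fun w => ?_)
  rw [norm_mul, Real.norm_of_nonneg ENNReal.toReal_nonneg]
  exact mul_le_mul_of_nonneg_left (norm_boundaryMean_le P L g w) ENNReal.toReal_nonneg

/-- The walk started far out ends up, on average, near its starting point: the Floyd distance from
`v` to `Z_∞` is at most the Floyd length of the trajectory. -/
theorem IsBoundaryLimit.tendsto_boundaryMean_sub (hL : IsBoundaryLimit G e f P L)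
    (hU : Tendsto (totalFloydLength G e f P) (atInfinity G e) (𝓝 0))
    (g : C(FloydCompletion G e f, ℝ)) :
    Tendsto (fun v => boundaryMean P L g v - g (toCompletion G e f v)) (atInfinity G e) (𝓝 0) := by
  rw [tendsto_iff_edist_tendsto_0, ENNReal.tendsto_nhds_zero]
  intro ε hε
  obtain ⟨c, hc, hmod⟩ := exists_edist_le_add_mul g (ENNReal.half_pos hε.ne')
  have hcU : Tendsto (fun v => c * totalFloydLength G e f P v) (atInfinity G e) (𝓝 0) := by
    simpa using ENNReal.Tendsto.const_mul hU (Or.inr hc)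
  filter_upwards [ENNReal.tendsto_nhds_zero.1 hcU (ε / 2) (ENNReal.half_pos hε.ne')] with v hv
  have hpt : ∀ᵐ z ∂pathMeasure P v, ‖g (L z) - g (toCompletion G e f v)‖ₑ ≤
      ε / 2 + c * ∑' n, floydDist G e f (z n) (z (n + 1)) := by
    filter_upwards [hL.ae_tendsto v, pathMeasure_ae_zero P v] with z hz hz0
    rw [← edist_eq_enorm_sub, edist_comm]
    refine le_of_tendsto (tendsto_const_nhds.edist ((g.continuous.tendsto _).comp hz))
      (Eventually.of_forall fun n => (hmod v (z n)).trans ?_)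
    gcongr
    calc floydDist G e f v (z n)
        = edist (show FloydSpace G e f from z 0) (show FloydSpace G e f from z n) := by
          rw [hz0]; rfl
      _ ≤ ∑ i ∈ Finset.range n, floydDist G e f (z i) (z (i + 1)) :=
          edist_le_range_sum_edist (fun n => (show FloydSpace G e f from z n)) n
      _ ≤ _ := ENNReal.sum_le_tsum _
  have hint : Integrable (fun z => g (L z)) (pathMeasure P v) :=
    Integrable.of_bound (g.continuous.measurable.comp hL.measurable_coe).aestronglyMeasurable ‖g‖
      (ae_of_all _ fun z => g.norm_coe_le_norm _)
  have hsub : boundaryMean P L g v - g (toCompletion G e f v) =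
      ∫ z, (g (L z) - g (toCompletion G e f v)) ∂pathMeasure P v := by
    rw [integral_sub hint (integrable_const _)]
    simp [boundaryMean]
  calc edist (boundaryMean P L g v - g (toCompletion G e f v)) 0
      = ‖∫ z, (g (L z) - g (toCompletion G e f v)) ∂pathMeasure P v‖ₑ := by
        rw [edist_zero_right, hsub]
    _ ≤ ∫⁻ z, ‖g (L z) - g (toCompletion G e f v)‖ₑ ∂pathMeasure P v :=
        enorm_integral_le_lintegral_enorm _
    _ ≤ ∫⁻ z, (ε / 2 + c * ∑' n, floydDist G e f (z n) (z (n + 1))) ∂pathMeasure P v :=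
        lintegral_mono_ae hpt
    _ = ε / 2 + c * totalFloydLength G e f P v := by
        rw [lintegral_add_left measurable_const, lintegral_const_mul' _ _ hc,
          lintegral_tsum_floydDist]
        simp
    _ ≤ ε / 2 + ε / 2 := by gcongr
    _ = ε := ENNReal.add_halves ε

/-- The solution of the Dirichlet problem with boundary values `g` is `v ↦ E_v g(Z_∞)`. -/
theorem IsBoundaryLimit.exists_harmonic_extension (hL : IsBoundaryLimit G e f P L)
    (hf : ∀ n, 0 < f n) (hconn : G.Connected) (hlf : ∀ v : V, (G.neighborSet v).Finite)
    (hU : Tendsto (totalFloydLength G e f P) (atInfinity G e) (𝓝 0))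
    (g : C(floydBoundary G e f, ℝ)) :
    ∃ H : C(FloydCompletion G e f, ℝ),
      (∀ v, H (toCompletion G e f v) = ∫ z, g (L z) ∂pathMeasure P v) ∧
      (∀ ξ : floydBoundary G e f, H ξ = g ξ) ∧
      ∀ v, HasSum (fun w => (P v w).toReal * H (toCompletion G e f w))
        (H (toCompletion G e f v)) := by
  obtain ⟨g', hg'⟩ := ContinuousMap.exists_restrict_eq (isClosed_floydBoundary hf) g
  have hg'ξ : ∀ ξ : floydBoundary G e f, g' ξ = g ξ := fun ξ => DFunLike.congr_fun hg' ξ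
  obtain ⟨H, hHv, hHξ⟩ := exists_continuous_extension hf hconn hlf g' (boundaryMean P L g')
    (hL.tendsto_boundaryMean_sub hU g')
  refine ⟨H, fun v => ?_, fun ξ => (hHξ ξ).trans (hg'ξ ξ), fun v => ?_⟩
  · simp only [hHv, boundaryMean, hg'ξ]
  · simp only [hHv]
    exact hL.hasSum_boundaryMean g' v

end Boundary

end Floyd

end

theorem mainTheorem2 {V : Type*} [MeasurableSpace V] [DiscreteMeasurableSpace V]
    (G : SimpleGraph V) (hconn : G.Connected) (hlf : ∀ v : V, (G.neighborSet v).Finite)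
    (e : V) (P : V → PMF V)
    (hirr : Floyd.UniformlyIrreducible G P)
    (hmom : Floyd.UniformFirstMoment G P)
    (a b : V) (hρ : Floyd.spectralRadius P a b < 1)
    (C : ℝ≥0)
    (hdecay : ∀ (n : ℕ) (v w : V), Floyd.nStep P n v w ≤ C * Floyd.spectralRadius P a b ^ n)
    (f : ℕ → ℝ≥0) (hf : Floyd.IsFloydFunction f)
    (hfsum : Summable (fun n : ℕ => (n : ℝ≥0) * f n)) :
    Floyd.DirichletSolvable G e f P ∧
    ∃ (L : (ℕ → V) → Floyd.floydBoundary G e f) (hL : Floyd.IsBoundaryLimit G e f P L),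
      ∀ ξ : Floyd.floydBoundary G e f,
        Tendsto (Floyd.hittingDistribution hL) (Floyd.vertexNhds G e f ξ)
          (𝓝 (Floyd.diracAt ξ)) := by
  have := Floyd.countable_of_connected hconn hlf
  have := hconn.nonempty
  obtain ⟨F, -, hFs, hfF⟩ := hf.exists_antitone_majorant
  have := Floyd.compactSpace_floydCompletion
    (Floyd.totallyBounded_floydSpace hconn hlf e hFs hfF)
  obtain ⟨hUfin, hU⟩ :=
    Floyd.totalFloydLength_ne_top_and_tendsto hconn hlf e hirr hmom hρ hdecay hf
  obtain ⟨L, hL⟩ := Floyd.exists_isBoundaryLimit hf.pos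
    (fun v w => ((Floyd.floydDist_le_diam hconn e hFs hfF v w).trans_lt ENNReal.coe_lt_top).ne)
    (Floyd.ae_exists_tendsto_floydBoundary hf.pos hρ hdecay hUfin)
  have hext := hL.exists_harmonic_extension hf.pos hconn hlf hU
  refine ⟨fun g => ?_, L, hL, fun ξ => ?_⟩
  · obtain ⟨H, -, hHξ, hH⟩ := hext g
    exact ⟨H, hH, hHξ⟩
  · rw [ProbabilityMeasure.tendsto_iff_forall_integral_tendsto]
    intro g
    obtain ⟨H, hHv, hHξ, -⟩ := hext g.toContinuousMap
    have hlim : Tendsto (fun v => H (Floyd.toCompletion G e f v)) (Floyd.vertexNhds G e f ξ)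
        (𝓝 (H ξ)) := (H.continuous.tendsto _).comp tendsto_comap
    have hμ : ∀ v, ∫ x, g x ∂(Floyd.hittingDistribution hL v : Measure _) =
        H (Floyd.toCompletion G e f v) := fun v => by
      rw [hHv]
      exact integral_map (μ := Floyd.pathMeasure P v) hL.measurable.aemeasurable
        g.continuous.measurable.aestronglyMeasurable
    have hδ : ∫ x, g x ∂(Floyd.diracAt ξ : Measure _) = H ξ := by
      rw [hHξ]
      exact integral_dirac' _ _ g.continuous.measurable.stronglyMeasurable
    simpa only [hμ, hδ] using hlim
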